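/- Let $\mathbb{F}$ be an algebraically closed field of characteristic $0$, let $\mathbb{L}$ be a finite-dimensional semisimple Lie algebra over $\mathbb{F}$, let $H$ be a maximal torus of $\mathbb{L}$ (a subalgebra maximal among those consisting of ad-semisimple elements), and let $\Phi\subset H^*\setminus\{0\}$ be the corresponding set of roots, with root spaces $\mathbb{L}_\alpha=\{x\in\mathbb{L} : [h,x]=\alpha(h)x \text{ for all } h\in H\}$. A subalgebra $L$ of $\mathbb{L}$ is called $Q$-graded if $L=H\oplus\bigoplus_{\alpha\in\Psi}\mathbb{L}_\alpha$ for some $\Psi\subseteq\Phi$ with $\operatorname{span}_{\mathbb{Z}}\Psi=\operatorname{span}_{\mathbb{Z}}\Phi$; it is called minimal $Q$-graded if moreover no $Q$-graded subalgebra $L_1$ of $\mathbb{L}$ satisfies $L_1\subsetneq L$. Let $L$ be a minimal $Q$-graded subalgebra of $\mathbb{L}$ with $\dim H=\dim[L,L]$, and let $S=\mathbb{F}[t,t^{-1}]$ be the algebra of Laurent polynomials. Regard the loop algebra $L\otimes_{\mathbb{F}} S$, with bracket $[x\otimes f,y\otimes g]=[x,y]\otimes fg$, as a Lie algebra over $\mathbb{F}$.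 Let $\operatorname{Der}$ denote the space of $\mathbb{F}$-linear derivations and let $\operatorname{Cent}(L)=\{\varphi\in\operatorname{End}_{\mathbb{F}}(L) : \varphi([x,y])=[\varphi(x),y]=[x,\varphi(y)] \text{ for all } x,y\in L\}$ be the centroid of $L$. **Theorem 4.8.** As vector spaces, $$\operatorname{Der}(L\otimes S)=\operatorname{Der}(L)\otimes S\;\oplus\;\operatorname{Cent}(L)\otimes\operatorname{Der}(S),$$ where $D\otimes s$ (with $D\in\operatorname{Der}(L)$, $s\in S$) is identified with the derivation $x\otimes f\mapsto D(x)\otimes sf$, and $\varphi\otimes d$ (with $\varphi\in\operatorname{Cent}(L)$, $d\in\operatorname{Der}(S)$) with the derivation $x\otimes f\mapsto\varphi(x)\otimes d(f)$; that is, these formulas define a linear isomorphism from the external direct sum on the right onto $\operatorname{Der}(L\otimes S)$. Moreover, every almost inner derivation of $L\otimes S$, i.e. every derivation $D$ such that for each $w\in L\otimes S$ there is $y\in L\otimes S$ with $D(w)=[w,y]$, is inner, i.e. of the form $\operatorname{ad} y$ for a single $y\in L\otimes S$. -/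

import Mathlib

open scoped TensorProduct LaurentPolynomial

namespace QGraded

section Subalgebras

variable {F 𝕃 : Type*} [Field F] [LieRing 𝕃] [LieAlgebra F 𝕃]

/-- A torus (toral subalgebra): a subalgebra all of whose elements are ad-semisimple. -/
def IsTorus (H : LieSubalgebra F 𝕃) : Prop :=
  ∀ x ∈ H, (LieAlgebra.ad F 𝕃 x).IsSemisimple

/-- A maximal torus: maximal with respect to inclusion among all tori. -/
def IsMaximalTorus (H : LieSubalgebra F 𝕃) : Prop :=
  Maximal IsTorus H

/-- The simultaneous eigenspace `{x | ∀ h ∈ H, [h, x] = α(h) x}`. -/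
def rootSpace (H : LieSubalgebra F 𝕃) (α : Module.Dual F H) : Submodule F 𝕃 where
  carrier := {x | ∀ h : H, ⁅(h : 𝕃), x⁆ = α h • x}
  add_mem' := by
    intro x y hx hy h
    rw [lie_add, hx h, hy h, smul_add]
  zero_mem' := by
    intro h
    rw [lie_zero, smul_zero]
  smul_mem' := by
    intro c x hx h
    rw [lie_smul, hx h, smul_comm]

/-- The set `Φ` of roots with respect to `H`: nonzero linear forms with nonzero root space. -/
def roots (H : LieSubalgebra F 𝕃) : Set (Module.Dual F H) :=
  {α | α ≠ 0 ∧ rootSpace H α ≠ ⊥}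

/-- `L` is a `Q`-graded subalgebra: `L = H ⊕ ⨁_{α ∈ Ψ} L_α` for a set `Ψ ⊆ Φ` which generates the
root lattice `Q = ℤΦ` as an abelian group. (The sum is automatically direct when `H` is abelian,
because the `L_α` are simultaneous eigenspaces for distinct nonzero forms and `H` lies in the
one for the zero form.) -/
def IsQGraded (H L : LieSubalgebra F 𝕃) : Prop :=
  ∃ Ψ : Set (Module.Dual F H), Ψ ⊆ roots H ∧
    L.toSubmodule = H.toSubmodule ⊔ ⨆ α ∈ Ψ, rootSpace H α ∧
    AddSubgroup.closure Ψ = AddSubgroup.closure (roots H)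

/-- A `Q`-graded subalgebra that properly contains no `Q`-graded subalgebra. -/
def IsMinimalQGraded (H L : LieSubalgebra F 𝕃) : Prop :=
  IsQGraded H L ∧ ¬ ∃ L₁ : LieSubalgebra F 𝕃, IsQGraded H L₁ ∧ L₁ < L

end Subalgebras

section Derivations

variable (F A : Type*) [Field F] [LieRing A] [LieAlgebra F A]

/-- `Der(A)`: the `F`-linear derivations of the Lie algebra `A`. -/
abbrev Der := LieDerivation F A A

/-- `Cent(A)`: the centroid of the Lie algebra `A`, as a unital subalgebra of `End(A)`. -/
def centroid : Subalgebra F (Module.End F A) where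
  carrier := {φ | ∀ x y : A, φ ⁅x, y⁆ = ⁅φ x, y⁆ ∧ φ ⁅x, y⁆ = ⁅x, φ y⁆}
  mul_mem' := by
    intro φ ψ hφ hψ x y
    simp only [Module.End.mul_apply]
    exact ⟨by rw [(hψ x y).1, (hφ _ _).1], by rw [(hψ x y).2, (hφ _ _).2]⟩
  add_mem' := by
    intro φ ψ hφ hψ x y
    simp only [LinearMap.add_apply]
    exact ⟨by rw [(hφ x y).1, (hψ x y).1, add_lie], by rw [(hφ x y).2, (hψ x y).2, lie_add]⟩
  algebraMap_mem' := by
    intro c x y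
    simp only [Module.algebraMap_end_apply]
    exact ⟨(smul_lie c x y).symm, (lie_smul c x y).symm⟩

variable {F A}

/-- A derivation `D` is almost inner if `D(x) ∈ [x, A]` for every `x`. -/
def IsAlmostInner (D : Der F A) : Prop :=
  ∀ x : A, ∃ y : A, D x = ⁅x, y⁆

/-- A derivation `D` is inner if `D = ad y` for some `y`. -/
def IsInner (D : Der F A) : Prop :=
  ∃ y : A, ∀ x : A, D x = ⁅y, x⁆

end Derivations

/-- The loop algebra `L ⊗ S`, `S = F[t, t⁻¹]`, with bracket `[x ⊗ f, y ⊗ g] = [x, y] ⊗ f g`,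
regarded as a Lie algebra over `F`. Mathlib writes the scalar factor on the left, so `x ⊗ f` is
`f ⊗ₜ x` below. -/
abbrev Loop (F L : Type*) [Field F] [LieRing L] [LieAlgebra F L] :=
  F[T;T⁻¹] ⊗[F] L

end QGraded

namespace QGraded

/-! ### Derivations of sums of copies of the two-dimensional nonabelian algebra -/

section BorelBasis

variable {ι S M : Type*} [CommRing S] [LieRing M] [LieAlgebra S M]

/-! The dimension condition forces `L` to be a direct sum of two-dimensional nonabelian algebras
with bases `h_i`, `x_i` and `[h_i, x_i] = x_i` (`IsQGraded.exists_isBorelBasis`). Over any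
commutative `S`, an `F`-linear derivation of `S ⊗ L` then has a normal form with free parameters
`p_i, q_i ∈ S` and `δ_i ∈ Der(S)` (`exists_derivation_form`). The `p_i, q_i` account for `Der(L) ⊗
S`, as `Der(L)` is spanned by the `ad h_i` and `ad x_i`; the `δ_i` account for `Cent(L) ⊗ Der(S)`,
as the centroid is spanned by the projections onto the summands. Brackets have no `h_i`-components,
so almost innerness kills every `δ_i` and leaves an inner derivation. -/

open Classical in
/-- A basis `h_i = c (inl i)`, `x_i = c (inr i)` whose only nonzero brackets are
`[h_i, x_i] = x_i` up to sign: it exhibits `M` as a direct sum of copies of the two-dimensional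
nonabelian Lie algebra. -/
structure IsBorelBasis (c : Module.Basis (ι ⊕ ι) S M) : Prop where
  inl_inl : ∀ i j, ⁅c (.inl i), c (.inl j)⁆ = 0
  inr_inr : ∀ i j, ⁅c (.inr i), c (.inr j)⁆ = 0
  inl_inr : ∀ i j, ⁅c (.inl i), c (.inr j)⁆ = if i = j then c (.inr j) else 0

namespace IsBorelBasis

variable {c : Module.Basis (ι ⊕ ι) S M} (hc : IsBorelBasis c)
include hc

open Classical in
lemma inr_inl (i j : ι) : ⁅c (.inr i), c (.inl j)⁆ = if i = j then - c (.inr i) else 0 := by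
  rw [← lie_skew, hc.inl_inr]
  split_ifs <;> simp_all

lemma lie_eq_sum [Fintype ι] (w z : M) :
    ⁅w, z⁆ = ∑ i, (c.repr w (.inl i) * c.repr z (.inr i) - c.repr w (.inr i) * c.repr z (.inl i)) •
      c (.inr i) := by
  classical
  conv_lhs => rw [← c.sum_repr w, ← c.sum_repr z]
  simp only [Fintype.sum_sum_type, add_lie, lie_add, sum_lie, lie_sum, smul_lie,
    lie_smul, hc.inl_inl, hc.inr_inr, hc.inl_inr, hc.inr_inl, smul_zero, Finset.sum_const_zero,
    smul_ite, Finset.sum_ite_eq', Finset.mem_univ, if_true, smul_neg]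
  simp only [zero_add, add_zero, ← Finset.sum_add_distrib]
  refine Finset.sum_congr rfl fun i _ ↦ ?_
  module

variable [Fintype ι]

lemma repr_lie_inl (w z : M) (i : ι) : c.repr ⁅w, z⁆ (.inl i) = 0 := by
  rw [hc.lie_eq_sum]
  simp

lemma repr_lie_inr (w z : M) (i : ι) : c.repr ⁅w, z⁆ (.inr i) =
    c.repr w (.inl i) * c.repr z (.inr i) - c.repr w (.inr i) * c.repr z (.inl i) := by
  classical
  rw [hc.lie_eq_sum]
  simp [Finsupp.single_apply]

variable {F : Type*} [CommRing F] [LieAlgebra F M]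

-- Since `D` is only `F`-linear, it is tested on `S`-multiples of basis vectors. The vanishing
-- brackets kill the off-diagonal coefficients. If `α`, `β` are the diagonal coefficients of `D (f •
-- h_i)`, `D (f • x_i)`, then `[f h_i, g x_i] = fg x_i` gives `β(fg) = f β(g) + g α(f)`; `g = 1`
-- yields `β(f) = α(f) + β(1) f`, and substituting back makes `α` a derivation.
variable [Algebra F S] [IsScalarTower F S M] in
lemma exists_derivation_form (D : LieDerivation F M M) :
    ∃ (p q : ι → S) (δ : ι → Derivation F S S), ∀ i f,
      D (f • c (.inl i)) = δ i f • c (.inl i) + (q i * f) • c (.inr i) ∧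
      D (f • c (.inr i)) = (δ i f + p i * f) • c (.inr i) := by
  classical
  have key (w z : M) (k : ι ⊕ ι) : c.repr (D ⁅w, z⁆) k = c.repr ⁅w, D z⁆ k - c.repr ⁅z, D w⁆ k := by
    rw [D.apply_lie_eq_sub, map_sub, Finsupp.sub_apply]
  have h1 (f : S) (i k : ι) : c.repr (D (f • c (.inl i))) (.inr k) =
      if i = k then c.repr (D (c (.inl i))) (.inr i) * f else 0 := by
    have := key (f • c (.inl i)) (c (.inl k)) (.inr k)
    simp only [smul_lie, hc.inl_inl, smul_zero, map_zero, map_smul, Finsupp.smul_apply,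
      hc.repr_lie_inr] at this
    rcases eq_or_ne i k with rfl | h
    · simp at this
      simp only [if_true]
      linear_combination this
    · simpa [h, h.symm, Finsupp.single_apply] using this
  have h2 (f g : S) (i j k : ι) := key (f • c (.inl i)) (g • c (.inr j)) (.inr k)
  have h3 (g : S) (j k : ι) : c.repr (D (g • c (.inr j))) (.inl k) = 0 := by
    have := key (c (.inl j)) (g • c (.inr j)) (.inl k)
    simpa only [lie_smul, hc.inl_inr, if_true, hc.repr_lie_inl, sub_zero] using this
  simp only [hc.repr_lie_inr, smul_lie, lie_smul, hc.inl_inr, smul_ite, smul_zero, smul_smul,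
    map_smul, Module.Basis.repr_self, Finsupp.smul_apply, smul_eq_mul, Finsupp.single_apply,
    reduceCtorEq, if_false, Sum.inl.injEq, Sum.inr.injEq, zero_mul, zero_sub, sub_zero]
    at h2
  have h4 (f : S) (i k : ι) (hik : i ≠ k) : c.repr (D (f • c (.inl i))) (.inl k) = 0 := by
    have := h2 f 1 i k k
    simpa [hik] using this.symm
  have h5 (g : S) (i k : ι) (hik : i ≠ k) : c.repr (D (g • c (.inr i))) (.inr k) = 0 := by
    have := h2 1 g k i k
    simpa [hik, hik.symm] using this.symm
  have h6 (f g : S) (i : ι) : c.repr (D ((f * g) • c (.inr i))) (.inr i) =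
      f * c.repr (D (g • c (.inr i))) (.inr i) + g * c.repr (D (f • c (.inl i))) (.inl i) := by
    have := h2 f g i i i
    simpa [mul_comm g f] using this
  have h7 (f : S) (i : ι) : c.repr (D (f • c (.inr i))) (.inr i) =
      c.repr (D (f • c (.inl i))) (.inl i) + c.repr (D (c (.inr i))) (.inr i) * f := by
    have := h6 f 1 i
    simp only [mul_one, one_smul, one_mul] at this
    rw [this]; ring
  refine ⟨fun i ↦ c.repr (D (c (.inr i))) (.inr i), fun i ↦ c.repr (D (c (.inl i))) (.inr i),
    fun i ↦ Derivation.mk'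
      { toFun := fun f ↦ c.repr (D (f • c (.inl i))) (.inl i)
        map_add' := fun f g ↦ by rw [add_smul, map_add, map_add, Finsupp.add_apply]
        map_smul' := fun r f ↦ by
          rw [smul_assoc, map_smul, ← algebraMap_smul S r, map_smul, Finsupp.smul_apply,
            algebraMap_smul, RingHom.id_apply] }
      fun f g ↦ ?_, fun i f ↦ ⟨?_, ?_⟩⟩
  · have e := h6 f g i
    rw [h7, h7] at e
    simp only [LinearMap.coe_mk, AddHom.coe_mk, smul_eq_mul]
    linear_combination e
  · apply c.ext_elem
    rintro (k | k)
    · rcases eq_or_ne i k with rfl | h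
      · simp
      · simp [h4 f i k h, h]
    · rw [h1]
      rcases eq_or_ne i k with rfl | h <;> simp [*]
  · apply c.ext_elem
    rintro (k | k)
    · simp [h3]
    · rcases eq_or_ne i k with rfl | h
      · simp [h7]
      · simp [h5 f i k h, h]

omit [Fintype ι] hc in
lemma _root_.LieDerivation.ext_smul_basis {κ : Type*} (b : Module.Basis κ S M)
    {D₁ D₂ : LieDerivation F M M} (h : ∀ (f : S) k, D₁ (f • b k) = D₂ (f • b k)) : D₁ = D₂ := by
  ext w
  induction b.mem_span w using Submodule.closure_induction with
  | zero => simp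
  | add x y _ _ hx hy => rw [map_add, map_add, hx, hy]
  | smul_mem f x hx => obtain ⟨k, rfl⟩ := hx; exact h f k

end IsBorelBasis
end BorelBasis
-- Tori, roots and the structure of `L`
section Torus

variable {F 𝕃 : Type*} [Field F] [LieRing 𝕃] [LieAlgebra F 𝕃] {H : LieSubalgebra F 𝕃}

variable [FiniteDimensional F 𝕃]

/-- `H` is spanned by eigenvectors `z` of `ad x`. If `[x, z] = μ z`, then `(ad z)² x = 0`, so
semisimplicity of `ad z` gives `[z, x] = 0`. -/
lemma IsTorus.lie_eq_zero [IsAlgClosed F] (hH : IsTorus H) {x y : 𝕃} (hx : x ∈ H) (hy : y ∈ H) :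
    ⁅x, y⁆ = 0 := by
  have hmap : ∀ z ∈ H.toSubmodule, LieAlgebra.ad F 𝕃 x z ∈ H.toSubmodule :=
    fun z hz ↦ H.lie_mem hx hz
  have h1 := Submodule.inf_iSup_genEigenspace hmap 1
  have h2 : ⨆ μ, (LieAlgebra.ad F 𝕃 x).genEigenspace μ 1 = ⊤ := (hH x hx).iSup_eigenspace_eq_top
  rw [h2, inf_top_eq] at h1
  have h3 : H.toSubmodule ≤ LinearMap.ker (LieAlgebra.ad F 𝕃 x) := by
    rw [h1]
    refine iSup_le fun μ z hz ↦ ?_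
    obtain ⟨hzH, hz⟩ := Submodule.mem_inf.mp hz
    have hz : ⁅x, z⁆ = μ • z := Module.End.mem_eigenspace_iff.mp hz
    have h4 : x ∈ (LieAlgebra.ad F 𝕃 z).genEigenspace 0 2 := by
      rw [show (2 : ℕ∞) = (2 : ℕ) from rfl, Module.End.mem_genEigenspace_nat]
      rw [zero_smul, sub_zero, LinearMap.mem_ker, pow_two, Module.End.mul_apply]
      rw [LieAlgebra.ad_apply, LieAlgebra.ad_apply, show ⁅z, x⁆ = -(μ • z) by rw [← hz, lie_skew]]
      simp
    rw [(hH z hzH).isFinitelySemisimple.genEigenspace_eq_eigenspace 0 (by norm_num),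
      Module.End.mem_eigenspace_iff, zero_smul, LieAlgebra.ad_apply] at h4
    rw [LinearMap.mem_ker, LieAlgebra.ad_apply, ← lie_skew, h4, neg_zero]
  exact h3 hy

lemma IsTorus.iSup_rootSpace_eq_top [IsAlgClosed F] (hH : IsTorus H) :
    ⨆ α : Module.Dual F H, rootSpace H α = ⊤ := by
  have h1 := Module.End.iSup_iInf_maxGenEigenspace_eq_top_of_iSup_maxGenEigenspace_eq_top_of_commute
    (fun h : H ↦ LieAlgebra.ad F 𝕃 (h : 𝕃)) (fun a b _ ↦ ?_)
    (fun h ↦ Module.End.iSup_maxGenEigenspace_eq_top _)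
  · rw [eq_top_iff, ← h1]
    refine iSup_le fun χ ↦ ?_
    have h2 (x : 𝕃) (hx : x ∈ ⨅ h : H, (LieAlgebra.ad F 𝕃 (h : 𝕃)).maxGenEigenspace (χ h)) (h : H) :
        ⁅(h : 𝕃), x⁆ = χ h • x := by
      have := (Submodule.mem_iInf _).mp hx h
      rw [(hH h h.2).isFinitelySemisimple.maxGenEigenspace_eq_eigenspace] at this
      exact Module.End.mem_eigenspace_iff.mp this
    intro x hx
    rcases eq_or_ne x 0 with rfl | hx0
    · exact Submodule.zero_mem _
    -- A nonzero joint eigenvector makes its eigenvalue function linear.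
    refine Submodule.mem_iSup_of_mem
      ({ toFun := χ, map_add' := fun a b ↦ ?_, map_smul' := fun r a ↦ ?_ } : Module.Dual F H) ?_
    · apply smul_left_injective F hx0
      simp only [add_smul, ← h2 x hx, ← add_lie]
      rfl
    · apply smul_left_injective F hx0
      simp only [RingHom.id_apply, smul_eq_mul, mul_smul, ← h2 x hx, ← smul_lie]
      rfl
    · exact fun h ↦ h2 x hx h
  · change LieAlgebra.ad F 𝕃 (a : 𝕃) * LieAlgebra.ad F 𝕃 (b : 𝕃) = _ * _
    ext z
    rw [Module.End.mul_apply, Module.End.mul_apply]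
    change ⁅(a : 𝕃), ⁅(b : 𝕃), z⁆⁆ = ⁅(b : 𝕃), ⁅(a : 𝕃), z⁆⁆
    rw [leibniz_lie, hH.lie_eq_zero a.2 b.2, zero_lie, zero_add]

/-- A functional killing all roots is evaluation at some `h ∈ H`; this `h` acts as zero on every
root space, so it is central and hence zero. -/
lemma IsTorus.span_roots_eq_top [IsAlgClosed F] [LieAlgebra.HasTrivialRadical F 𝕃] (hH : IsTorus H) :
    Submodule.span F (roots H) = ⊤ := by
  by_contra hne
  obtain ⟨g, hg0, hg⟩ := Submodule.exists_le_ker_of_lt_top _ (lt_top_iff_ne_top.mpr hne)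
  obtain ⟨h, rfl⟩ := (Module.evalEquiv F H).surjective g
  refine hg0 ?_
  suffices hc : (h : 𝕃) ∈ LieAlgebra.center F 𝕃 by
    rw [LieAlgebra.center_eq_bot, LieSubmodule.mem_bot] at hc
    rw [show h = 0 from Subtype.ext hc, map_zero]
  rw [LieModule.mem_maxTrivSubmodule]
  suffices ∀ x : 𝕃, ⁅(h : 𝕃), x⁆ = 0 from fun x ↦ by rw [← lie_skew, this, neg_zero]
  suffices (⊤ : Submodule F 𝕃) ≤ LinearMap.ker (LieAlgebra.ad F 𝕃 (h : 𝕃)) from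
    fun x ↦ this (Submodule.mem_top)
  rw [← hH.iSup_rootSpace_eq_top]
  refine iSup_le fun α x hx ↦ ?_
  rw [LinearMap.mem_ker, LieAlgebra.ad_apply, hx h]
  by_cases hα : α ∈ roots H
  · have : α h = 0 := hg (Submodule.subset_span hα)
    rw [this, zero_smul]
  · simp only [roots, Set.mem_ofPred_eq, not_and, not_not] at hα
    by_cases h0 : α = 0
    · simp [h0]
    · have := hα h0 ▸ hx
      rw [(Submodule.mem_bot F).mp this, smul_zero]

/-- Choose a basis of `H*` inside `Ψ`, its dual basis `h_i`, and one root vector `x_i` for each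
basis root. The `x_i = [h_i, x_i]` are independent in `[L, L]`, and by the dimension count they span
it. -/
theorem IsQGraded.exists_isBorelBasis [IsAlgClosed F] [LieAlgebra.HasTrivialRadical F 𝕃]
    (hH : IsTorus H) {L : LieSubalgebra F 𝕃} (hL : IsQGraded H L)
    (hdim : Module.finrank F H =
      Module.finrank F (⁅(⊤ : LieIdeal F L), (⊤ : LieIdeal F L)⁆ : LieIdeal F L)) :
    ∃ (ι : Set (Module.Dual F H)) (_ : Fintype ι) (c : Module.Basis (ι ⊕ ι) F L),
      IsBorelBasis c := by
  classical
  obtain ⟨Ψ, hΨ, hLΨ, hcl⟩ := hL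
  have hspan : Submodule.span F Ψ = ⊤ := by
    rw [eq_top_iff, ← hH.span_roots_eq_top, Submodule.span_le]
    intro α hα
    have h1 : α ∈ AddSubgroup.closure Ψ := hcl ▸ AddSubgroup.subset_closure hα
    have h2 : AddSubgroup.closure Ψ ≤ (Submodule.span F Ψ).toAddSubgroup :=
      (AddSubgroup.closure_le _).mpr Submodule.subset_span
    exact h2 h1
  obtain ⟨ι, hιΨ, hιspan, hli⟩ := exists_linearIndependent F Ψ
  let B : Module.Basis ι F (Module.Dual F H) := Module.Basis.mk hli (by
    rw [Subtype.range_coe, hιspan, hspan])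
  have : Fintype ι := FiniteDimensional.fintypeBasisIndex B
  let h : Module.Basis ι F H := B.dualBasis.map (Module.evalEquiv F H).symm
  have hBh (i j : ι) : (j : Module.Dual F H) (h i) = if j = i then 1 else 0 := by
    have h1 : (j : Module.Dual F H) (h i) = Module.evalEquiv F H (h i) (B j) := by simp [B]
    rw [h1]
    simp [h, -Module.evalEquiv_apply, Finsupp.single_apply]
  have hHL : H ≤ L := by
    change H.toSubmodule ≤ L.toSubmodule
    exact hLΨ ▸ le_sup_left
  have hΨL {α} (hα : α ∈ Ψ) : rootSpace H α ≤ L.toSubmodule :=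
    hLΨ ▸ le_sup_of_le_right (le_biSup (fun α ↦ rootSpace H α) hα)
  have hex (i : ι) : ∃ x ∈ rootSpace H (i : Module.Dual F H), x ≠ 0 :=
    Submodule.exists_mem_ne_zero_of_ne_bot (hΨ (hιΨ i.2)).2
  choose x hx hx0 using hex
  have hhx (i j : ι) : ⁅(h i : 𝕃), x j⁆ = if i = j then x j else 0 := by
    rw [hx j (h i), hBh]
    rcases eq_or_ne i j with rfl | hij
    · simp
    · simp [hij, hij.symm]
  have hhh (i j : ι) : ⁅(h i : 𝕃), (h j : 𝕃)⁆ = 0 := hH.lie_eq_zero (h i).2 (h j).2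
  have hind : LinearIndependent F (Sum.elim (fun i ↦ (h i : 𝕃)) x) := by
    rw [Fintype.linearIndependent_iff]
    intro g hg
    simp only [Fintype.sum_sum_type, Sum.elim_inl, Sum.elim_inr] at hg
    have h1 (i : ι) : g (.inr i) = 0 := by
      have := congr_arg (fun y ↦ ⁅(h i : 𝕃), y⁆) hg
      simpa [lie_sum, hhh, hhx, hx0] using this
    have h2 : ∑ i, g (.inl i) • h i = 0 := by
      apply Subtype.coe_injective
      simpa [h1] using hg
    rintro (i | i)
    · exact Fintype.linearIndependent_iff.mp h.linearIndependent _ h2 i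
    · exact h1 i
  have hxind : LinearIndependent F x := by
    simpa [Function.comp_def] using hind.comp Sum.inr Sum.inr_injective
  let D : Submodule F 𝕃 :=
    (⁅(⊤ : LieIdeal F L), (⊤ : LieIdeal F L)⁆ : LieIdeal F L).toSubmodule.map L.toSubmodule.subtype
  have hlieD {y z : 𝕃} (hy : y ∈ L) (hz : z ∈ L) : ⁅y, z⁆ ∈ D :=
    ⟨⁅(⟨y, hy⟩ : L), (⟨z, hz⟩ : L)⁆,
      LieSubmodule.lie_mem_lie (LieSubmodule.mem_top _) (LieSubmodule.mem_top _), rfl⟩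
  have hxL (i : ι) : x i ∈ L := hΨL (hιΨ i.2) (hx i)
  have hspanD : Submodule.span F (Set.range x) = D := by
    apply Submodule.eq_of_le_of_finrank_eq
    · rw [Submodule.span_le]
      rintro _ ⟨i, rfl⟩
      have := hlieD (hHL (h i).2) (hxL i)
      rwa [hhx, if_pos rfl] at this
    · rw [finrank_span_eq_card hxind, ← Module.finrank_eq_card_basis h, hdim]
      exact (LinearEquiv.finrank_eq (Submodule.equivMapOfInjective _
        L.toSubmodule.subtype_injective _))
  have hxx (i j : ι) : ⁅x i, x j⁆ = 0 := by
    rcases eq_or_ne i j with rfl | hij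
    · exact lie_self _
    have hmem : ⁅x i, x j⁆ ∈ Submodule.span F (Set.range x) := hspanD ▸ hlieD (hxL i) (hxL j)
    obtain ⟨a, ha⟩ := (Submodule.mem_span_range_iff_exists_fun F).mp hmem
    -- `[x_i, x_j]` has eigenvalue 1 under both `h_i` and `h_j`, whereas each `x_k` has eigenvalue 1
    -- under `h_k` only.
    have h1 : a i • x i = ⁅x i, x j⁆ := by
      have := congr_arg (fun y ↦ ⁅(h i : 𝕃), y⁆) ha
      simpa [lie_sum, leibniz_lie, hhx, hij] using this
    have h2 := congr_arg (fun y ↦ ⁅(h j : 𝕃), y⁆) h1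
    simpa [leibniz_lie, hhx, hij.symm] using h2.symm
  let c' : ι ⊕ ι → L := Sum.elim (fun i ↦ ⟨h i, hHL (h i).2⟩) (fun i ↦ ⟨x i, hxL i⟩)
  have hc' : L.toSubmodule.subtype ∘ c' = Sum.elim (fun i ↦ (h i : 𝕃)) x := by
    ext (i | i) <;> rfl
  have hc'ind : LinearIndependent F c' := by
    apply LinearIndependent.of_comp L.toSubmodule.subtype
    rwa [hc']
  have hc'span : ⊤ ≤ Submodule.span F (Set.range c') := by
    rw [← Submodule.map_le_map_iff_of_injective L.toSubmodule.subtype_injective, Submodule.map_top,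
      Submodule.range_subtype, Submodule.map_span, ← Set.range_comp, hc', Set.Sum.elim_range,
      Submodule.span_union]
    rw [hLΨ, hspanD]
    refine sup_le_sup ?_ (iSup₂_le fun α hα y hy ↦ ?_)
    · intro y hy
      have := h.mem_span ⟨y, hy⟩
      have := Submodule.mem_map_of_mem (f := H.toSubmodule.subtype) this
      rwa [Submodule.map_span, ← Set.range_comp] at this
    -- As `α ≠ 0`, a vector of weight `α` is a multiple of a bracket, so it already lies in `[L,
    -- L]`.
    · obtain ⟨k, hk⟩ : ∃ k, α k ≠ 0 := by
        by_contra! hk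
        exact (hΨ hα).1 (LinearMap.ext hk)
      have h1 := D.smul_mem (α k)⁻¹ (hlieD (hHL k.2) (hΨL hα hy))
      rwa [hy k, inv_smul_smul₀ hk] at h1
  refine ⟨ι, this, Module.Basis.mk hc'ind hc'span, ?_, ?_, ?_⟩ <;> intro i j <;>
    rw [Module.Basis.mk_apply, Module.Basis.mk_apply] <;> apply Subtype.coe_injective
  · exact hhh i j
  · exact hxx i j
  · refine (hhx i j).trans ?_
    split_ifs with hij
    · rfl
    · rfl

end Torus
lemma _root_.LieDerivation.sum_apply {R A N κ : Type*} [CommRing R] [LieRing A] [LieAlgebra R A]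
    [AddCommGroup N] [Module R N] [LieRingModule A N] [LieModule R A N] (s : Finset κ)
    (D : κ → LieDerivation R A N) (x : A) : (∑ k ∈ s, D k) x = ∑ k ∈ s, D k x := by
  rw [← LieDerivation.coeFnAddMonoidHom_apply, map_sum, Finset.sum_apply]
  rfl

/-! ### The two families of derivations of `S ⊗ M` -/

section TensorDerivations

variable {F S M : Type*} [CommRing F] [CommRing S] [Algebra F S] [LieRing M] [LieAlgebra F M]

/-- A linear endomorphism of `S ⊗ M` satisfying the Leibniz rule on pure tensors is a derivation. -/
def derivationOfTmul (φ : Module.End F (S ⊗[F] M))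
    (h : ∀ (f g : S) (x y : M), φ ⁅f ⊗ₜ[F] x, g ⊗ₜ[F] y⁆ =
      ⁅f ⊗ₜ[F] x, φ (g ⊗ₜ[F] y)⁆ - ⁅g ⊗ₜ[F] y, φ (f ⊗ₜ[F] x)⁆) :
    LieDerivation F (S ⊗[F] M) (S ⊗[F] M) where
  toLinearMap := φ
  leibniz' w z := by
    induction w with
    | zero => simp
    | add w₁ w₂ h₁ h₂ => rw [add_lie, map_add, map_add, h₁, h₂, add_lie, lie_add]; abel
    | tmul f x =>
      induction z with
      | zero => simp
      | add w₁ w₂ h₁ h₂ => rw [lie_add, map_add, map_add, h₁, h₂, add_lie, lie_add]; abel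
      | tmul g y => exact h f g x y

variable (F S M) in
/-- The map `Der(M) ⊗ S → Der(M ⊗ S)`. -/
noncomputable def mulDerivation :
    LieDerivation F M M ⊗[F] S →ₗ[F] LieDerivation F (S ⊗[F] M) (S ⊗[F] M) :=
  TensorProduct.lift <| LinearMap.mk₂ F
    (fun D s ↦ derivationOfTmul (TensorProduct.map (LinearMap.mulLeft F s) D.toLinearMap)
      fun f g x y ↦ by
        simp [TensorProduct.tmul_sub, mul_left_comm, mul_comm g f])
    (fun D₁ D₂ s ↦ by
      ext w; exact congr($(TensorProduct.map_add_right (LinearMap.mulLeft F s)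
        D₁.toLinearMap D₂.toLinearMap) w))
    (fun r D s ↦ by
      ext w; exact congr($(TensorProduct.map_smul_right r (LinearMap.mulLeft F s)
        D.toLinearMap) w))
    (fun D s t ↦ by
      ext w; exact (congr(TensorProduct.map $(map_add (LinearMap.mul F S) s t)
        D.toLinearMap w)).trans congr($(TensorProduct.map_add_left (LinearMap.mulLeft F s)
          (LinearMap.mulLeft F t) D.toLinearMap) w))
    (fun r D s ↦ by
      ext w; exact (congr(TensorProduct.map $(map_smul (LinearMap.mul F S) r s)
        D.toLinearMap w)).trans congr($(TensorProduct.map_smul_left r (LinearMap.mulLeft F s)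
          D.toLinearMap) w))

@[simp] lemma mulDerivation_tmul (D : LieDerivation F M M) (s f : S) (x : M) :
    mulDerivation F S M (D ⊗ₜ s) (f ⊗ₜ x) = (s * f) ⊗ₜ D x := rfl

end TensorDerivations

section CentroidDerivations

variable {F S M : Type*} [Field F] [CommRing S] [Algebra F S] [LieRing M] [LieAlgebra F M]

variable (F S M) in
/-- The map `Cent(M) ⊗ Der(S) → Der(M ⊗ S)`. -/
noncomputable def centroidDerivation :
    centroid F M ⊗[F] Derivation F S S →ₗ[F] LieDerivation F (S ⊗[F] M) (S ⊗[F] M) :=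
  TensorProduct.lift <| LinearMap.mk₂ F
    (fun φ d ↦ derivationOfTmul (TensorProduct.map d.toLinearMap (φ : Module.End F M))
      fun f g x y ↦ by
        have h1 := (φ.2 x y).2
        have h2 : (φ : Module.End F M) ⁅x, y⁆ = - ⁅y, (φ : Module.End F M) x⁆ := by
          rw [(φ.2 x y).1, lie_skew]
        simp only [LieAlgebra.ExtendScalars.bracket_tmul, TensorProduct.map_tmul, ← h1,
          show ⁅y, (φ : Module.End F M) x⁆ = - (φ : Module.End F M) ⁅x, y⁆ by rw [h2, neg_neg],
          Derivation.coeFn_coe, Derivation.leibniz,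
          smul_eq_mul, TensorProduct.add_tmul, TensorProduct.tmul_neg, sub_neg_eq_add])
    (fun φ₁ φ₂ d ↦ by
      ext w; exact congr($(TensorProduct.map_add_right d.toLinearMap
        (φ₁ : Module.End F M) (φ₂ : Module.End F M)) w))
    (fun r φ d ↦ by
      ext w; exact congr($(TensorProduct.map_smul_right r d.toLinearMap
        (φ : Module.End F M)) w))
    (fun φ d₁ d₂ ↦ by
      ext w; exact congr($(TensorProduct.map_add_left d₁.toLinearMap d₂.toLinearMap
        (φ : Module.End F M)) w))
    (fun r φ d ↦ by
      ext w; exact congr($(TensorProduct.map_smul_left r d.toLinearMap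
        (φ : Module.End F M)) w))

@[simp] lemma centroidDerivation_tmul (φ : centroid F M) (d : Derivation F S S) (f : S) (x : M) :
    centroidDerivation F S M (φ ⊗ₜ d) (f ⊗ₜ x) = d f ⊗ₜ (φ : Module.End F M) x := rfl

end CentroidDerivations

/-- Spanning suffices for the injectivity argument: the coefficients are recovered from the action
on basis vectors, so independence of `v` is not needed. -/
lemma _root_.TensorProduct.exists_sum_tmul_of_span_eq_top {R N P κ : Type*} [CommRing R]
    [AddCommGroup N] [Module R N] [AddCommGroup P] [Module R P] [Fintype κ] {v : κ → N}
    (hv : Submodule.span R (Set.range v) = ⊤) (z : N ⊗[R] P) :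
    ∃ p : κ → P, z = ∑ k, v k ⊗ₜ[R] p k := by
  induction z with
  | zero => exact ⟨0, by simp⟩
  | add z₁ z₂ h₁ h₂ =>
    obtain ⟨p₁, rfl⟩ := h₁
    obtain ⟨p₂, rfl⟩ := h₂
    exact ⟨p₁ + p₂, by simp [TensorProduct.tmul_add, Finset.sum_add_distrib]⟩
  | tmul n p =>
    obtain ⟨a, rfl⟩ := (Submodule.mem_span_range_iff_exists_fun R).mp
      (hv ▸ Submodule.mem_top : n ∈ Submodule.span R (Set.range v))
    exact ⟨fun k ↦ a k • p, by simp [TensorProduct.sum_tmul, TensorProduct.smul_tmul]⟩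

/-! ### Centroid and derivations of `M` -/

namespace IsBorelBasis

variable {ι F M : Type*} [Field F] [LieRing M] [LieAlgebra F M] {b : Module.Basis (ι ⊕ ι) F M}

lemma baseChange (hb : IsBorelBasis b) (S : Type*) [CommRing S] [Algebra F S] :
    IsBorelBasis (b.baseChange S) where
  inl_inl i j := by simp [hb.inl_inl]
  inr_inr i j := by simp [hb.inr_inr]
  inl_inr i j := by
    classical
    simp only [Module.Basis.baseChange_apply, LieAlgebra.ExtendScalars.bracket_tmul, hb.inl_inr]
    split_ifs <;> simp

variable (b) in
open Classical in
/-- The projection of `M` onto the span of `b (inl i)` and `b (inr i)`. -/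
noncomputable def proj (i : ι) : Module.End F M :=
  b.constr F fun k ↦ if k.elim id id = i then b k else 0

open Classical in
lemma proj_inl (i j : ι) : proj b i (b (.inl j)) = if j = i then b (.inl j) else 0 := by
  simp only [proj, Module.Basis.constr_basis, Sum.elim_inl, id_eq]
  congr

open Classical in
lemma proj_inr (i j : ι) : proj b i (b (.inr j)) = if j = i then b (.inr j) else 0 := by
  simp only [proj, Module.Basis.constr_basis, Sum.elim_inr, id_eq]
  congr

lemma proj_mem_centroid (hb : IsBorelBasis b) (i : ι) : proj b i ∈ centroid F M := by
  classical
  have h1 : (LieModule.toEnd F M M : M →ₗ[F] Module.End F M).compr₂ (proj b i) =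
      (LieModule.toEnd F M M : M →ₗ[F] Module.End F M).comp (proj b i) := by
    refine b.ext fun k ↦ b.ext fun l ↦ ?_
    rcases k with k | k <;> rcases l with l | l <;>
      simp [proj_inl, proj_inr, hb.inl_inl, hb.inr_inr, hb.inl_inr, hb.inr_inl] <;>
      split_ifs <;> simp_all [hb.inl_inl, hb.inr_inr, hb.inl_inr, hb.inr_inl, proj_inr]
  have h2 (x y : M) : proj b i ⁅x, y⁆ = ⁅proj b i x, y⁆ := congr($h1 x y)
  exact fun x y ↦ ⟨h2 x y, by rw [← lie_skew, map_neg, h2, lie_skew]⟩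

/-- Compatibility with `[h_i, x_k]` and `[h_k, h_i]` forces `φ h_i = a_i h_i`; then `φ x_i = [φ h_i,
x_i] = a_i x_i`. -/
lemma span_proj_eq_top [Fintype ι] (hb : IsBorelBasis b) :
    Submodule.span F (Set.range fun i ↦ (⟨proj b i, hb.proj_mem_centroid i⟩ : centroid F M)) = ⊤ := by
  classical
  rw [eq_top_iff]
  rintro ⟨φ, hφ⟩ -
  refine (Submodule.mem_span_range_iff_exists_fun F).mpr ⟨fun i ↦ b.repr (φ (b (.inl i))) (.inl i), ?_⟩
  apply Subtype.coe_injective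
  have h1 (i k : ι) (hik : i ≠ k) : b.repr (φ (b (.inl i))) (.inl k) = 0 := by
    have := congr(b.repr $((hφ (b (.inl i)) (b (.inr k))).1) (.inr k))
    simpa [hb.inl_inr, hik, hb.repr_lie_inr] using this.symm
  have h2 (i k : ι) : b.repr (φ (b (.inl i))) (.inr k) = 0 := by
    have := congr(b.repr $((hφ (b (.inl k)) (b (.inl i))).2) (.inr k))
    simpa [hb.inl_inl, hb.repr_lie_inr] using this.symm
  have h3 (i : ι) : φ (b (.inr i)) = b.repr (φ (b (.inl i))) (.inl i) • b (.inr i) := by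
    have := (hφ (b (.inl i)) (b (.inr i))).1
    rw [hb.inl_inr, if_pos rfl] at this
    rw [this, hb.lie_eq_sum]
    simp [Finsupp.single_apply]
  simp only [AddSubmonoidClass.coe_finsetSum, SetLike.val_smul]
  refine b.ext ?_
  rintro (i | i)
  · simp only [LinearMap.sum_apply, LinearMap.smul_apply, proj_inl]
    apply b.ext_elem
    rintro (k | k)
    · rcases eq_or_ne i k with rfl | hik
      · simp
      · simp [h1 i k hik, hik]
    · simp [h2]
  · simp [proj_inr, h3]

/-- This is the normal form with `S = F`, where every `δ_i` is an `F`-derivation of `F` and so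
vanishes. -/
lemma span_inner_eq_top [Fintype ι] (hb : IsBorelBasis b) :
    Submodule.span F (Set.range fun k ↦ LieDerivation.inner F M M (b k)) = ⊤ := by
  classical
  rw [eq_top_iff]
  rintro D -
  obtain ⟨p, q, δ, h⟩ := hb.exists_derivation_form (S := F) D
  have hδ (i : ι) (f : F) : δ i f = 0 := (δ i).map_algebraMap f
  -- The sign arises because `LieDerivation.inner` at `m` is `x ↦ ⁅x, m⁆`.
  refine (Submodule.mem_span_range_iff_exists_fun F).mpr ⟨Sum.elim (fun i ↦ - p i) q, ?_⟩
  apply LieDerivation.ext_smul_basis b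
  rintro f (i | i)
  · rw [(h i f).1]
    simp [hb.inl_inl, hb.inl_inr, hδ, LieDerivation.sum_apply, smul_smul, mul_comm]
  · rw [(h i f).2]
    simp [hb.inr_inl, hb.inr_inr, hδ, LieDerivation.sum_apply, smul_smul, mul_comm]

end IsBorelBasis
end QGraded

/-! ### The decomposition of `Der(S ⊗ M)` and almost inner derivations -/

namespace QGraded.IsBorelBasis

variable {ι F M : Type*} [Fintype ι] [Field F] [LieRing M] [LieAlgebra F M]
  {b : Module.Basis (ι ⊕ ι) F M} (hb : IsBorelBasis b) (S : Type*) [CommRing S] [Algebra F S]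
include hb

/-- Matching this with `exists_derivation_form` gives surjectivity; reading off coefficients gives
injectivity. -/
lemma coprod_derivation_apply (p : ι ⊕ ι → S) (δ : ι → Derivation F S S) (f : S) (i : ι) :
    (mulDerivation F S M).coprod (centroidDerivation F S M)
      (∑ k, LieDerivation.inner F M M (b k) ⊗ₜ p k,
        ∑ j, (⟨proj b j, hb.proj_mem_centroid j⟩ : centroid F M) ⊗ₜ δ j)
      (f • b.baseChange S (.inl i)) =
        δ i f • b.baseChange S (.inl i) + (p (.inr i) * f) • b.baseChange S (.inr i) ∧
    (mulDerivation F S M).coprod (centroidDerivation F S M)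
      (∑ k, LieDerivation.inner F M M (b k) ⊗ₜ p k,
        ∑ j, (⟨proj b j, hb.proj_mem_centroid j⟩ : centroid F M) ⊗ₜ δ j)
      (f • b.baseChange S (.inr i)) = (δ i f - p (.inl i) * f) • b.baseChange S (.inr i) := by
  classical
  constructor
  · simp [LieDerivation.sum_apply, TensorProduct.smul_tmul', proj_inl, hb.inl_inl, hb.inl_inr,
      apply_ite (TensorProduct.tmul F _), add_comm]
  · simp [LieDerivation.sum_apply, TensorProduct.smul_tmul', proj_inr, hb.inr_inr, hb.inr_inl,
      apply_ite (TensorProduct.tmul F _), TensorProduct.tmul_neg,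
      sub_eq_neg_add, TensorProduct.add_tmul, TensorProduct.neg_tmul]

theorem bijective_coprod_derivation :
    Function.Bijective ((mulDerivation F S M).coprod (centroidDerivation F S M)) := by
  classical
  have hc := hb.baseChange S
  constructor
  · rw [injective_iff_map_eq_zero]
    rintro ⟨u, v⟩ huv
    obtain ⟨p, rfl⟩ := TensorProduct.exists_sum_tmul_of_span_eq_top hb.span_inner_eq_top u
    obtain ⟨δ, rfl⟩ := TensorProduct.exists_sum_tmul_of_span_eq_top hb.span_proj_eq_top v
    have h (f : S) (i : ι) := hb.coprod_derivation_apply S p δ f i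
    simp only [huv, LieDerivation.zero_apply] at h
    have hδ (i : ι) : δ i = 0 := by
      ext f
      simpa using congr((b.baseChange S).repr $((h f i).1) (.inl i)).symm
    have hq (i : ι) : p (.inr i) = 0 := by
      simpa [hδ] using congr((b.baseChange S).repr $((h 1 i).1) (.inr i)).symm
    have hp (i : ι) : p (.inl i) = 0 := by
      simpa [hδ] using congr((b.baseChange S).repr $((h 1 i).2) (.inr i)).symm
    simp [hδ, hp, hq]
  · intro D
    obtain ⟨p, q, δ, h⟩ := hc.exists_derivation_form D
    refine ⟨(∑ k, LieDerivation.inner F M M (b k) ⊗ₜ Sum.elim (fun i ↦ - p i) q k,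
      ∑ j, (⟨proj b j, hb.proj_mem_centroid j⟩ : centroid F M) ⊗ₜ δ j), ?_⟩
    apply LieDerivation.ext_smul_basis (b.baseChange S)
    rintro f (i | i)
    · rw [(h i f).1, (hb.coprod_derivation_apply S _ δ f i).1, Sum.elim_inr]
    · rw [(h i f).2, (hb.coprod_derivation_apply S _ δ f i).2, Sum.elim_inl, neg_mul, sub_neg_eq_add]

omit hb in
theorem isInner_of_isAlmostInner {A : Type*} [LieRing A] [LieAlgebra F A] [LieAlgebra S A]
    [IsScalarTower F S A] {c : Module.Basis (ι ⊕ ι) S A} (hc : IsBorelBasis c) {D : Der F A}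
    (hD : IsAlmostInner D) : IsInner D := by
  classical
  obtain ⟨p, q, δ, h⟩ := hc.exists_derivation_form D
  have hδ (i : ι) (f : S) : δ i f = 0 := by
    obtain ⟨y, hy⟩ := hD (f • c (.inl i))
    rw [(h i f).1] at hy
    simpa [hc.repr_lie_inl] using congr(c.repr $hy (.inl i))
  -- Chosen so that `[y, h_i] = q_i x_i` and `[y, x_i] = p_i x_i`.
  let y : A := ∑ i, p i • c (.inl i) - ∑ i, q i • c (.inr i)
  suffices D = LieDerivation.inner F A A (-y) from
    ⟨y, fun x ↦ by rw [this, LieDerivation.inner_apply_apply, lie_neg, lie_skew]⟩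
  apply LieDerivation.ext_smul_basis c
  rintro f (i | i)
  · rw [(h i f).1]
    simp [y, hδ, LieDerivation.sum_apply, hc.inl_inl, hc.inl_inr, smul_smul, mul_comm]
  · rw [(h i f).2]
    simp [y, hδ, LieDerivation.sum_apply, hc.inr_inl, hc.inr_inr, smul_smul, mul_comm]

end QGraded.IsBorelBasis

theorem theorem4p8 {F 𝕃 : Type*} [Field F] [IsAlgClosed F] [CharZero F]
    [LieRing 𝕃] [LieAlgebra F 𝕃] [FiniteDimensional F 𝕃] [LieAlgebra.IsSemisimple F 𝕃]
    (H : LieSubalgebra F 𝕃) (hH : QGraded.IsMaximalTorus H)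
    (L : LieSubalgebra F 𝕃) (hL : QGraded.IsMinimalQGraded H L)
    (hdim : Module.finrank F H = Module.finrank F (⁅(⊤ : LieIdeal F L), (⊤ : LieIdeal F L)⁆ : LieIdeal F L)) :
    (∃ e : ((QGraded.Der F L ⊗[F] F[T;T⁻¹]) ×
          (QGraded.centroid F L ⊗[F] Derivation F F[T;T⁻¹] F[T;T⁻¹])) ≃ₗ[F]
          QGraded.Der F (QGraded.Loop F L),
        (∀ (D : QGraded.Der F L) (s f : F[T;T⁻¹]) (x : L),
          e (D ⊗ₜ[F] s, 0) (f ⊗ₜ[F] x) = (s * f) ⊗ₜ[F] D x) ∧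
        (∀ (φ : QGraded.centroid F L) (d : Derivation F F[T;T⁻¹] F[T;T⁻¹])
          (f : F[T;T⁻¹]) (x : L),
          e (0, φ ⊗ₜ[F] d) (f ⊗ₜ[F] x) = d f ⊗ₜ[F] (φ : Module.End F L) x)) ∧
    ∀ D : QGraded.Der F (QGraded.Loop F L), QGraded.IsAlmostInner D → QGraded.IsInner D := by
  obtain ⟨ι, _, c, hc⟩ := hL.1.exists_isBorelBasis hH.prop hdim
  refine ⟨⟨LinearEquiv.ofBijective _ (hc.bijective_coprod_derivation F[T;T⁻¹]), fun D s f x ↦ ?_,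
    fun φ d f x ↦ ?_⟩, fun D hD ↦ (hc.baseChange F[T;T⁻¹]).isInner_of_isAlmostInner _ hD⟩
  · simp
  · simp
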